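/- Let $(X,d)$ be a complete metric space which is \emph{Busemann concave}: any two points are joined by a geodesic, i.e. a map $\gamma:[0,1]\to X$ with $d(\gamma(s),\gamma(t))=|s-t|\,d(\gamma(0),\gamma(1))$, and for any two geodesics $\gamma,\eta$ with $\gamma(0)=\eta(0)$ the function $t\mapsto d(\gamma(t),\eta(t))$ is concave on $[0,1]$. Let $n\in[0,\infty)$ and let $\mathcal H^n$ be the $n$-dimensional Hausdorff measure of $X$, normalized by the factor $\omega_n2^{-n}$, $\omega_n=\pi^{n/2}/\Gamma(\frac n2+1)$ (so that it is Lebesgue measure on Euclidean $\mathbb R^n$ for integers $n$). Assume that $\mathcal H^n$ is non-trivial, i.e. $0<\mathcal H^n(B_r(x))<\infty$ for some $x\in X$ and $r>0$, where $B_r(x)$ denotes the open ball. Then $0<\mathcal H^n(B_r(x))<\infty$ for all $x\in X$ and $r>0$, and the following hold. \begin{enumerate} \item (Measure contraction property $MCP(0,n)$.) For every $x\in X$ and every Borel set $A\subset X$ with $0<\mathcal H^n(A)<\infty$ there is a Borel probability measure $\Pi$ on the space of geodesics of $X$ (with the topology of uniform convergence) such that, with $e_t(\gamma)=\gamma(t)$,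 one has $(e_0)_*\Pi=\delta_x$, $(e_1)_*\Pi=\mathcal H^n(A)^{-1}\mathcal H^n|_A$ and \[(e_t)_*\bigl(t^n\,\mathcal H^n(A)\,\Pi\bigr)\le\mathcal H^n\qquad\text{for all }t\in[0,1].\] \item (Bishop--Gromov comparison $BG(0,n)$.) For all $x\in X$ and $0<r<R$, \[\frac{\mathcal H^n(B_R(x))}{\mathcal H^n(B_r(x))}\le\frac{\omega_nR^n}{\omega_nr^n}=\frac{R^n}{r^n}.\] \item (Doubling.) $\mathcal H^n(B_{2r}(x))\le 2^n\,\mathcal H^n(B_r(x))$ for all $x\in X$ and $r>0$. \item (Weak $(1,1)$-Poincar\'e inequality.) For all $x\in X$, $r>0$, every $u:X\to\mathbb R$ that is integrable on $B_r(x)$, and every $1$-weak upper gradient $g:X\to[0,\infty]$ of $u$, \[\int_{B_r(x)}|u-u_{B_r(x)}|\,d\mathcal H^n\le 2^{n+1}\,r\int_{B_{3r}(x)}g\,d\mathcal H^n,\qquad u_{B_r(x)}=\frac1{\mathcal H^n(B_r(x))}\int_{B_r(x)}u\,d\mathcal H^n.\] Here a Borel function $g$ is a $1$-weak upper gradient of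 $u$ if $|u(\gamma(0))-u(\gamma(L))|\le\int_0^Lg(\gamma(s))\,ds$ for all rectifiable curves $\gamma:[0,L]\to X$, $L>0$, parametrized by arc length, outside a family $F$ of vanishing $1$-modulus: the infimum of $\int_X\rho\,d\mathcal H^n$ over Borel $\rho:X\to[0,\infty]$ with $\int_0^L\rho(\gamma(s))\,ds\ge1$ for all $\gamma\in F$ is $0$. \end{enumerate} -/

import Mathlib

open MeasureTheory Set
open scoped ENNReal unitInterval

noncomputable section

namespace BusemannConcave

/-- Constant speed (minimal) geodesics parametrized by `[0,1]`:
`d(γ(s), γ(t)) = |s - t| d(γ(0), γ(1))`. -/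
def Geod (X : Type*) [MetricSpace X] : Type _ :=
  {γ : C(I, X) // ∀ s t : I, dist (γ s) (γ t) = |(s : ℝ) - t| * dist (γ 0) (γ 1)}

/-- The topology of uniform convergence on the space of geodesics. -/
instance (X : Type*) [MetricSpace X] : TopologicalSpace (Geod X) :=
  inferInstanceAs (TopologicalSpace
    {γ : C(I, X) // ∀ s t : I, dist (γ s) (γ t) = |(s : ℝ) - t| * dist (γ 0) (γ 1)})

/-- The Borel σ-algebra on the space of geodesics. -/
instance (X : Type*) [MetricSpace X] : MeasurableSpace (Geod X) := borel (Geod X)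

instance (X : Type*) [MetricSpace X] : BorelSpace (Geod X) := ⟨rfl⟩

/-- The evaluation map `e_t(γ) = γ(t)`. -/
def ev {X : Type*} [MetricSpace X] (t : I) (γ : Geod X) : X := γ.1 t

/-- Any two points are joined by a geodesic. -/
def IsGeodesicSpace (X : Type*) [MetricSpace X] : Prop :=
  ∀ x y : X, ∃ γ : Geod X, ev 0 γ = x ∧ ev 1 γ = y

/-- A geodesic space is Busemann concave if `t ↦ d(γ(t), η(t))` is concave on `[0,1]` for all
geodesics `γ`, `η` with a common starting point. (`IccExtend` only serves to regard a function
on the unit interval as a function of a real variable.) -/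
def IsBusemannConcave (X : Type*) [MetricSpace X] : Prop :=
  IsGeodesicSpace X ∧
    ∀ γ η : Geod X, ev 0 γ = ev 0 η →
      ConcaveOn ℝ (Icc (0 : ℝ) 1)
        (IccExtend zero_le_one fun t : I => dist (ev t γ) (ev t η))

/-- The constant `ω_n = π^{n/2} / Γ(n/2 + 1)`, for integers `n` the volume of the unit ball
of `n`-dimensional Euclidean space. -/
def omega (n : ℝ) : ℝ := Real.pi ^ (n / 2) / Real.Gamma (n / 2 + 1)

/-- The volume `ω_n r^n` of a ball of radius `r` in the flat `n`-dimensional model space. -/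
def modelVolume (n r : ℝ) : ℝ := omega n * r ^ n

/-- The `n`-dimensional Hausdorff measure, with the normalization
`ω_n ∑ (diam U_i / 2)^n`, which for integers `n` gives Lebesgue measure on Euclidean `ℝⁿ`. -/
def hausdorff (X : Type*) [MetricSpace X] [MeasurableSpace X] [BorelSpace X] (n : ℝ) :
    Measure X :=
  ENNReal.ofReal (omega n / 2 ^ n) • Measure.hausdorffMeasure n

section MetricMeasure

variable {X : Type*} [MetricSpace X] [MeasurableSpace X]

/-- All balls of positive radius have positive and finite measure. -/
def BallsPosFinite (μ : Measure X) : Prop :=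
  ∀ (x : X) (r : ℝ), 0 < r → 0 < μ (Metric.ball x r) ∧ μ (Metric.ball x r) < ∞

/-- The measure contraction property `MCP(0,N)`: for every point `x` and every measurable `A` with
`0 < μ(A) < ∞` there is a probability measure `Π` on the space of geodesics whose evaluations
interpolate between `δ_x` and `μ|_A / μ(A)`, with `(e_t)_* (t^N μ(A) Π) ≤ μ` for `t ∈ [0,1]`.
(As one marginal is a Dirac mass, the coupling of the marginals induced by `Π` is the only one,
hence it is optimal.) -/
def MCPZero (μ : Measure X) (N : ℝ) : Prop :=
  BallsPosFinite μ ∧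
    ∀ (x : X) (A : Set X), MeasurableSet A → 0 < μ A → μ A < ∞ →
      ∃ P : Measure (Geod X), IsProbabilityMeasure P ∧
        P.map (ev 0) = Measure.dirac x ∧
        P.map (ev 1) = (μ A)⁻¹ • μ.restrict A ∧
        ∀ t : I, ((ENNReal.ofReal ((t : ℝ) ^ N) * μ A) • P).map (ev t) ≤ μ

/-- The Bishop–Gromov volume comparison `BG(0,N)`. -/
def BishopGromovZero (μ : Measure X) (N : ℝ) : Prop :=
  BallsPosFinite μ ∧
    ∀ (x : X) (r R : ℝ), 0 < r → r < R →
      μ (Metric.ball x R) / μ (Metric.ball x r) ≤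
        ENNReal.ofReal (modelVolume N R / modelVolume N r)

/-- `μ` is doubling with doubling constant `C`. -/
def IsDoublingWith (μ : Measure X) (C : ℝ≥0∞) : Prop :=
  BallsPosFinite μ ∧
    ∀ (x : X) (r : ℝ), 0 < r → μ (Metric.ball x (2 * r)) ≤ C * μ (Metric.ball x r)

end MetricMeasure

/-- Non-constant compact rectifiable curves, parametrized by arc length on `[0, length]`
(the values of `toFun` outside this interval play no role). -/
structure RectCurve (X : Type*) [MetricSpace X] where
  length : ℝ
  length_pos : 0 < length
  toFun : ℝ → X
  unitSpeed : HasUnitSpeedOn toFun (Icc 0 length)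

/-- The line integral `∫_γ g ds`. -/
def RectCurve.lineIntegral {X : Type*} [MetricSpace X] (γ : RectCurve X) (g : X → ℝ≥0∞) : ℝ≥0∞ :=
  ∫⁻ s in Icc 0 γ.length, g (γ.toFun s)

section UpperGradient

variable {X : Type*} [MetricSpace X] [MeasurableSpace X]

/-- The `1`-modulus of a family of rectifiable curves. -/
def modulusOne (μ : Measure X) (F : Set (RectCurve X)) : ℝ≥0∞ :=
  ⨅ (ρ : X → ℝ≥0∞) (_ : Measurable ρ) (_ : ∀ γ ∈ F, 1 ≤ γ.lineIntegral ρ), ∫⁻ x, ρ x ∂μ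

/-- A Borel function `g : X → [0,∞]` is a `1`-weak upper gradient of `u : X → ℝ` if
`|u(γ(0)) - u(γ(L))| ≤ ∫_γ g ds` for all rectifiable curves `γ` outside a family of vanishing
`1`-modulus. Upper gradients are the special case in which that family is empty. -/
def IsWeakUpperGradient (μ : Measure X) (u : X → ℝ) (g : X → ℝ≥0∞) : Prop :=
  Measurable g ∧
    modulusOne μ {γ : RectCurve X |
      ¬ ENNReal.ofReal |u (γ.toFun 0) - u (γ.toFun γ.length)| ≤ γ.lineIntegral g} = 0

/-- The weak `(1,1)`-Poincaré inequality
`∫_{B_r(x)} |u - u_{B_r(x)}| dμ ≤ C r ∫_{B_{lam r}(x)} g dμ`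
for all balls, all functions `u` integrable on the ball `B_r(x)` and all
`1`-weak upper gradients `g` of `u`. -/
def WeakPoincareOneOne (μ : Measure X) (C : ℝ≥0∞) (lam : ℝ) : Prop :=
  ∀ (x : X) (r : ℝ), 0 < r → ∀ (u : X → ℝ) (g : X → ℝ≥0∞),
    IntegrableOn u (Metric.ball x r) μ → IsWeakUpperGradient μ u g →
      ∫⁻ y in Metric.ball x r, ENNReal.ofReal |u y - ⨍ z in Metric.ball x r, u z ∂μ| ∂μ ≤
        C * ENNReal.ofReal r * ∫⁻ y in Metric.ball x (lam * r), g y ∂μ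

end UpperGradient

end BusemannConcave

end

namespace BusemannConcave

open Filter Topology

section Geodesics

variable {X : Type*} [MetricSpace X]

/-- The point of a geodesic at a real time, extended by constants outside `[0,1]`. -/
noncomputable def pt (γ : Geod X) (t : ℝ) : X := ev (projIcc 0 1 zero_le_one t) γ

theorem ev_eq_pt (γ : Geod X) (t : I) : ev t γ = pt γ t := by
  simp [pt]

theorem pt_zero (γ : Geod X) : pt γ 0 = ev 0 γ := by
  simpa using (ev_eq_pt γ 0).symm

theorem pt_one (γ : Geod X) : pt γ 1 = ev 1 γ := by
  simpa using (ev_eq_pt γ 1).symm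

theorem dist_pt (γ : Geod X) {s t : ℝ} (hs : s ∈ Icc (0 : ℝ) 1) (ht : t ∈ Icc (0 : ℝ) 1) :
    dist (pt γ s) (pt γ t) = |s - t| * dist (ev 0 γ) (ev 1 γ) := by
  have := γ.2 ⟨s, hs⟩ ⟨t, ht⟩
  simpa [pt, projIcc_of_mem zero_le_one hs, projIcc_of_mem zero_le_one ht, ev] using this

theorem dist_ev (γ : Geod X) (s t : I) :
    dist (ev s γ) (ev t γ) = |(s : ℝ) - t| * dist (ev 0 γ) (ev 1 γ) := γ.2 s t

theorem continuous_ev (t : I) : Continuous (ev t : Geod X → X) :=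
  (continuous_eval_const (F := C(I, X)) t).comp continuous_subtype_val

/-- A curve that is Lipschitz with constant the distance of its endpoints is a geodesic. -/
theorem exists_geod_of_dist_le (f : I → X)
    (h : ∀ s t : I, s ≤ t → dist (f s) (f t) ≤ ((t : ℝ) - s) * dist (f 0) (f 1)) :
    ∃ γ : Geod X, ∀ s, ev s γ = f s := by
  have key : ∀ s t : I, s ≤ t → dist (f s) (f t) = ((t : ℝ) - s) * dist (f 0) (f 1) := by
    intro s t hst
    refine le_antisymm (h s t hst) ?_
    have h1 := h 0 s s.2.1
    have h2 := h t 1 t.2.2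
    have h3 := dist_triangle4 (f 0) (f s) (f t) (f 1)
    simp only [Icc.coe_zero, Icc.coe_one] at h1 h2
    linarith
  have key' : ∀ s t : I, dist (f s) (f t) = |(s : ℝ) - t| * dist (f 0) (f 1) := by
    intro s t
    rcases le_total s t with hst | hst
    · rw [key s t hst, abs_sub_comm, abs_of_nonneg (sub_nonneg.2 (Subtype.coe_le_coe.2 hst))]
    · rw [dist_comm, key t s hst, abs_of_nonneg (sub_nonneg.2 (Subtype.coe_le_coe.2 hst))]
  have hc : Continuous f := by
    refine (LipschitzWith.of_dist_le_mul (K := (dist (f 0) (f 1)).toNNReal) ?_).continuous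
    intro s t
    rw [key', Real.coe_toNNReal _ dist_nonneg, mul_comm, Subtype.dist_eq, Real.dist_eq]
  exact ⟨⟨⟨f, hc⟩, key'⟩, fun s => rfl⟩

/-- `w` lies between `x` and `y` and divides the distance in the ratio `t : 1 - t`. -/
def DividesAt (t : ℝ) (x w y : X) : Prop :=
  dist x w = t * dist x y ∧ dist w y = (1 - t) * dist x y

theorem dividesAt_pt (γ : Geod X) {t : ℝ} (ht : t ∈ Icc (0 : ℝ) 1) :
    DividesAt t (ev 0 γ) (pt γ t) (ev 1 γ) := by
  constructor
  · rw [← pt_zero, dist_pt γ (by simp) ht, pt_zero, zero_sub, abs_neg, abs_of_nonneg ht.1]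
  · rw [← pt_one, dist_pt γ ht (by simp), pt_one, abs_sub_comm, abs_of_nonneg (sub_nonneg.2 ht.2)]

theorem exists_geod_concat (γ η : Geod X) {t : ℝ} (ht0 : 0 < t) (ht1 : t < 1)
    (hb : ev 1 γ = ev 0 η) (h : DividesAt t (ev 0 γ) (ev 0 η) (ev 1 η)) :
    ∃ θ : Geod X, ev 0 θ = ev 0 γ ∧ ev 1 θ = ev 1 η ∧
      ∀ s ∈ Icc (0 : ℝ) 1, pt θ (t * s) = pt γ s := by
  have ht1' : 0 < 1 - t := sub_pos.2 ht1
  set D := dist (ev 0 γ) (ev 1 η) with hD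
  have hγ : dist (ev 0 γ) (ev 1 γ) = t * D := by rw [hb]; exact h.1
  have hη : dist (ev 0 η) (ev 1 η) = (1 - t) * D := h.2
  let f : I → X := fun τ => if (τ : ℝ) ≤ t then pt γ (τ / t) else pt η ((τ - t) / (1 - t))
  have f0 : f 0 = ev 0 γ := by simp [f, ht0.le, pt_zero]
  have f1 : f 1 = ev 1 η := by simp [f, ht1, div_self ht1'.ne', pt_one]
  have memγ : ∀ τ : I, (τ : ℝ) ≤ t → (τ : ℝ) / t ∈ Icc (0 : ℝ) 1 := fun τ hτ =>
    ⟨div_nonneg τ.2.1 ht0.le, (div_le_one ht0).2 hτ⟩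
  have memη : ∀ τ : I, t ≤ (τ : ℝ) → ((τ : ℝ) - t) / (1 - t) ∈ Icc (0 : ℝ) 1 := fun τ hτ =>
    ⟨div_nonneg (sub_nonneg.2 hτ) ht1'.le, (div_le_one ht1').2 (by linarith [τ.2.2])⟩
  obtain ⟨θ, hθ⟩ := exists_geod_of_dist_le f (by
    intro s τ hsτ
    have hsτ' : (s : ℝ) ≤ τ := hsτ
    rw [f0, f1, ← hD]
    by_cases hτ : (τ : ℝ) ≤ t
    · have hs : (s : ℝ) ≤ t := hsτ'.trans hτ
      simp only [f, hs, hτ, if_true]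
      rw [dist_pt γ (memγ s hs) (memγ τ hτ), hγ, ← sub_div, abs_div, abs_of_pos ht0,
        abs_sub_comm, abs_of_nonneg (sub_nonneg.2 hsτ')]
      apply le_of_eq
      field_simp
    · have hτ' : t ≤ (τ : ℝ) := (not_le.1 hτ).le
      by_cases hs : (s : ℝ) ≤ t
      · simp only [f, hs, hτ, if_true, if_false]
        refine (dist_triangle _ (ev 0 η) _).trans ?_
        have e1 : dist (pt γ (s / t)) (ev 0 η) = (t - s) * D := by
          rw [← hb, ← pt_one, dist_pt γ (memγ s hs) (by simp), hγ, abs_sub_comm,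
            abs_of_nonneg (sub_nonneg.2 (memγ s hs).2)]
          field_simp
        have e2 : dist (ev 0 η) (pt η ((τ - t) / (1 - t))) = (τ - t) * D := by
          rw [← pt_zero, dist_pt η (by simp) (memη τ hτ'), hη, zero_sub, abs_neg,
            abs_of_nonneg (memη τ hτ').1]
          field_simp
        rw [e1, e2]
        apply le_of_eq
        ring
      · have hs' : t ≤ (s : ℝ) := (not_le.1 hs).le
        simp only [f, hs, hτ, if_false]
        rw [dist_pt η (memη s hs') (memη τ hτ'), hη, ← sub_div, abs_div, abs_of_pos ht1',
          abs_sub_comm, abs_of_nonneg (by linarith)]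
        apply le_of_eq
        field_simp
        ring)
  refine ⟨θ, by rw [hθ, f0], by rw [hθ, f1], fun s hs => ?_⟩
  have hm : t * s ∈ Icc (0 : ℝ) 1 :=
    ⟨mul_nonneg ht0.le hs.1, mul_le_one₀ ht1.le hs.1 hs.2⟩
  have hle : t * s ≤ t := mul_le_of_le_one_right ht0.le hs.2
  rw [pt, projIcc_of_mem zero_le_one hm, hθ]
  simp only [f, hle, if_true]
  rw [mul_div_cancel_left₀ _ ht0.ne']

theorem exists_geod_reverse (γ : Geod X) :
    ∃ θ : Geod X, ev 0 θ = ev 1 γ ∧ ev 1 θ = ev 0 γ ∧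
      ∀ s ∈ Icc (0 : ℝ) 1, pt θ s = pt γ (1 - s) := by
  obtain ⟨θ, hθ⟩ := exists_geod_of_dist_le (fun s => ev (unitInterval.symm s) γ) (by
    intro s t hst
    have hst' : (s : ℝ) ≤ t := hst
    simp only [unitInterval.symm_zero, unitInterval.symm_one]
    rw [dist_ev, dist_comm (ev 1 γ), unitInterval.coe_symm_eq, unitInterval.coe_symm_eq]
    apply le_of_eq
    congr 1
    rw [abs_of_nonneg] <;> linarith)
  refine ⟨θ, by simp [hθ], by simp [hθ], fun s hs => ?_⟩
  rw [pt, projIcc_of_mem zero_le_one hs, hθ, ev_eq_pt]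
  simp

end Geodesics

section Concavity

variable {X : Type*} [MetricSpace X]

theorem IsBusemannConcave.concaveOn_dist_pt (hX : IsBusemannConcave X) {γ η : Geod X}
    (h0 : ev 0 γ = ev 0 η) :
    ConcaveOn ℝ (Icc (0 : ℝ) 1) fun t => dist (pt γ t) (pt η t) := hX.2 γ η h0

theorem IsBusemannConcave.mul_dist_le (hX : IsBusemannConcave X) {γ η : Geod X}
    (h0 : ev 0 γ = ev 0 η) {t : ℝ} (ht : t ∈ Icc (0 : ℝ) 1) :
    t * dist (ev 1 γ) (ev 1 η) ≤ dist (pt γ t) (pt η t) := by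
  have := (hX.concaveOn_dist_pt h0).2 (show (0 : ℝ) ∈ _ by simp)
    (show (1 : ℝ) ∈ _ by simp)
    (sub_nonneg.2 ht.2) ht.1 (by ring)
  simpa [pt_zero, pt_one, h0] using this

/-- Geodesics with common starting point that meet at an interior time agree up to that time. -/
theorem IsBusemannConcave.pt_eq_of_pt_eq (hX : IsBusemannConcave X) {γ η : Geod X}
    (h0 : ev 0 γ = ev 0 η) {t : ℝ} (ht1 : t < 1) (h : pt γ t = pt η t)
    {s : ℝ} (hs : s ∈ Icc 0 t) : pt γ s = pt η s := by
  rcases hs.2.eq_or_lt with rfl | hst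
  · exact h
  have h1 : 0 < 1 - s := by linarith
  have := (hX.concaveOn_dist_pt h0).2 (show s ∈ _ from ⟨hs.1, by linarith⟩)
    (show (1 : ℝ) ∈ _ by simp)
    (show 0 ≤ (1 - t) / (1 - s) from div_nonneg (by linarith) h1.le)
    (show 0 ≤ (t - s) / (1 - s) from div_nonneg (by linarith) h1.le)
    (by field_simp; ring)
  have e : ((1 - t) / (1 - s)) • s + ((t - s) / (1 - s)) • (1 : ℝ) = t := by
    simp only [smul_eq_mul]; field_simp; ring
  rw [e] at this
  simp only [h, dist_self, smul_eq_mul] at this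
  have a1 : 0 < (1 - t) / (1 - s) := div_pos (by linarith) h1
  have a2 : 0 ≤ (t - s) / (1 - s) * dist (pt γ 1) (pt η 1) :=
    mul_nonneg (div_nonneg (by linarith) h1.le) dist_nonneg
  have a3 : (1 - t) / (1 - s) * dist (pt γ s) (pt η s) ≤ 0 := by linarith
  have a4 : dist (pt γ s) (pt η s) ≤ 0 := by
    by_contra hc
    exact absurd (mul_pos a1 (not_le.1 hc)) (not_lt.2 a3)
  exact dist_le_zero.1 a4

/-- Pairs `(x, y)` such that some geodesic from `x` passes through `y` at an interior time. -/
def extendable (X : Type*) [MetricSpace X] : Set (X × X) :=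
  {p | ∃ t : ℝ, 0 < t ∧ t < 1 ∧ ∃ w, DividesAt t p.1 p.2 w}

/-- Extendable pairs are joined by a unique geodesic. -/
theorem IsBusemannConcave.pt_eq_of_extendable (hX : IsBusemannConcave X) {γ η : Geod X}
    (h0 : ev 0 γ = ev 0 η) (h1 : ev 1 γ = ev 1 η) (h : (ev 0 γ, ev 1 γ) ∈ extendable X)
    {s : ℝ} (hs : s ∈ Icc (0 : ℝ) 1) : pt γ s = pt η s := by
  obtain ⟨t, ht0, ht1, w, hw⟩ := h
  obtain ⟨κ, hκ0, hκ1⟩ := hX.1 (ev 1 γ) w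
  obtain ⟨θ, hθ0, -, hθ⟩ := exists_geod_concat γ κ ht0 ht1 hκ0.symm (by rw [hκ0, hκ1]; exact hw)
  obtain ⟨τ, hτ0, -, hτ⟩ := exists_geod_concat η κ ht0 ht1 (by rw [hκ0, h1])
    (by rw [hκ0, hκ1, ← h0]; exact hw)
  rw [← hθ s hs, ← hτ s hs]
  refine hX.pt_eq_of_pt_eq (by rw [hθ0, hτ0, h0]) ht1 ?_
    ⟨mul_nonneg ht0.le hs.1, mul_le_of_le_one_right ht0.le hs.2⟩
  have e1 := hθ 1 (by simp)
  have e2 := hτ 1 (by simp)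
  rw [mul_one] at e1 e2
  rw [e1, e2, pt_one, pt_one, h1]

theorem IsBusemannConcave.pt_eq_of_dividesAt (hX : IsBusemannConcave X) {γ : Geod X}
    (h : (ev 0 γ, ev 1 γ) ∈ extendable X) {s : ℝ} (hs : s ∈ Icc (0 : ℝ) 1) {w : X}
    (hw : DividesAt s (ev 0 γ) w (ev 1 γ)) : pt γ s = w := by
  rcases hs.1.eq_or_lt with rfl | hs0
  · rw [pt_zero, ← dist_eq_zero, hw.1, zero_mul]
  rcases hs.2.eq_or_lt with rfl | hs1
  · rw [pt_one, eq_comm, ← dist_eq_zero, hw.2, sub_self, zero_mul]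
  obtain ⟨α, hα0, hα1⟩ := hX.1 (ev 0 γ) w
  obtain ⟨β, hβ0, hβ1⟩ := hX.1 w (ev 1 γ)
  obtain ⟨θ, hθ0, hθ1, hθ⟩ := exists_geod_concat α β hs0 hs1 (by rw [hα1, hβ0])
    (by rw [hα0, hβ0, hβ1]; exact hw)
  have e1 := hθ 1 (by simp)
  rw [mul_one, pt_one, hα1] at e1
  rw [← e1]
  exact hX.pt_eq_of_extendable (by rw [hθ0, hα0]) (by rw [hθ1, hβ1]) h hs

end Concavity

section Proper

theorem isClosed_image_fst_of_dist_le {P Y : Type*} [TopologicalSpace P] [MetricSpace Y]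
    [ProperSpace Y] {C : Set (P × Y)} (hC : IsClosed C) {c : P → Y} {b : P → ℝ}
    (hc : Continuous c) (hb : Continuous b) (h : ∀ p ∈ C, dist p.2 (c p.1) ≤ b p.1) :
    IsClosed (Prod.fst '' C) := by
  rw [isClosed_iff_ultrafilter]
  intro p U hU hmem
  have hex : ∀ q : P, ∃ w : Y, q ∈ Prod.fst '' C → (q, w) ∈ C := by
    intro q
    by_cases hq : q ∈ Prod.fst '' C
    · obtain ⟨⟨q', w⟩, hqw, rfl⟩ := hq
      exact ⟨w, fun _ => hqw⟩
    · exact ⟨c q, fun hq' => absurd hq' hq⟩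
  choose w hw using hex
  have hev : ∀ᶠ q in 𝓝 p, dist (c q) (c p) < 1 ∧ b q < b p + 1 :=
    ((Metric.continuous_iff'.1 hc p 1 one_pos)).and
      (hb.continuousAt.eventually_lt continuousAt_const (by linarith))
  have hball : ∀ᶠ q in (U : Filter P), w q ∈ Metric.closedBall (c p) (b p + 2) := by
    filter_upwards [hU hev, hmem] with q hq hqC
    have h1 := h _ (hw q hqC)
    have h2 := dist_triangle (w q) (c q) (c p)
    rw [Metric.mem_closedBall]
    simp only at h1
    linarith [hq.1, hq.2]
  obtain ⟨z, -, hz⟩ := (isCompact_closedBall (c p) (b p + 2)).ultrafilter_le_nhds (U.map w)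
    (by rw [le_principal_iff]; exact hball)
  have ht : Tendsto (fun q => (q, w q)) (U : Filter P) (𝓝 (p, z)) :=
    (show Tendsto id (U : Filter P) (𝓝 p) from hU).prodMk_nhds hz
  exact ⟨(p, z), hC.mem_of_tendsto ht (by filter_upwards [hmem] with q hq using hw q hq), rfl⟩

end Proper

section Selection

variable {X : Type*} [MetricSpace X]

/-- A choice of geodesics between any two points. -/
noncomputable def IsGeodesicSpace.geod (h : IsGeodesicSpace X) (x y : X) : Geod X :=
  (h x y).choose

theorem IsGeodesicSpace.ev_zero_geod (h : IsGeodesicSpace X) (x y : X) : ev 0 (h.geod x y) = x :=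
  (h x y).choose_spec.1

theorem IsGeodesicSpace.ev_one_geod (h : IsGeodesicSpace X) (x y : X) : ev 1 (h.geod x y) = y :=
  (h x y).choose_spec.2

theorem IsGeodesicSpace.dividesAt_geod (h : IsGeodesicSpace X) (x y : X) {t : ℝ}
    (ht : t ∈ Icc (0 : ℝ) 1) : DividesAt t x (pt (h.geod x y) t) y := by
  have := dividesAt_pt (h.geod x y) ht
  rwa [h.ev_zero_geod, h.ev_one_geod] at this

theorem isClosed_dividesAt {P : Type*} [TopologicalSpace P] {t : P → ℝ} {x w y : P → X}
    (ht : Continuous t) (hx : Continuous x) (hw : Continuous w) (hy : Continuous y) :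
    IsClosed {p | DividesAt (t p) (x p) (w p) (y p)} :=
  (isClosed_eq (f := fun p => dist (x p) (w p)) (g := fun p => t p * dist (x p) (y p))
    (by fun_prop) (by fun_prop)).inter
  (isClosed_eq (f := fun p => dist (w p) (y p)) (g := fun p => (1 - t p) * dist (x p) (y p))
    (by fun_prop) (by fun_prop))

theorem isClosed_setOf_exists_dividesAt [ProperSpace X] (k : ℕ) :
    IsClosed {p : X × X | ∃ t : ℝ, 1 / ((k : ℝ) + 2) ≤ t ∧ t ≤ 1 - 1 / ((k : ℝ) + 2) ∧
      ∃ w, DividesAt t p.1 p.2 w} := by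
  have hk : (0 : ℝ) < (k : ℝ) + 2 := by positivity
  let C : Set ((X × X) × (ℝ × X)) := {q | 1 / ((k : ℝ) + 2) ≤ q.2.1 ∧
    q.2.1 ≤ 1 - 1 / ((k : ℝ) + 2) ∧ DividesAt q.2.1 q.1.1 q.1.2 q.2.2}
  have hC : IsClosed C := by
    have h1 : IsClosed {q : (X × X) × (ℝ × X) | 1 / ((k : ℝ) + 2) ≤ q.2.1} :=
      isClosed_le (by fun_prop) (by fun_prop)
    have h2 : IsClosed {q : (X × X) × (ℝ × X) | q.2.1 ≤ 1 - 1 / ((k : ℝ) + 2)} :=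
      isClosed_le (by fun_prop) (by fun_prop)
    have h3 : IsClosed {q : (X × X) × (ℝ × X) | DividesAt q.2.1 q.1.1 q.1.2 q.2.2} :=
      isClosed_dividesAt (by fun_prop) (by fun_prop) (by fun_prop) (by fun_prop)
    exact h1.inter (h2.inter h3)
  convert isClosed_image_fst_of_dist_le hC (c := fun p => ((0 : ℝ), p.1))
    (b := fun p => 1 + ((k : ℝ) + 2) * dist p.1 p.2) (by fun_prop) (by fun_prop) ?_ using 1
  · ext p
    constructor
    · rintro ⟨t, h1, h2, w, hw⟩
      exact ⟨(p, (t, w)), ⟨h1, h2, hw⟩, rfl⟩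
    · rintro ⟨⟨q, t, w⟩, ⟨h1, h2, hw⟩, rfl⟩
      exact ⟨t, h1, h2, w, hw⟩
  · rintro ⟨⟨x, y⟩, t, w⟩ ⟨h1, h2, h3, h4⟩
    simp only at h1 h2 h3 h4
    have hk' : 0 < 1 / ((k : ℝ) + 2) := by positivity
    have hm : 0 ≤ ((k : ℝ) + 2) * dist x y := mul_nonneg hk.le dist_nonneg
    rw [Prod.dist_eq, max_le_iff]
    constructor
    · simp only [Real.dist_eq, sub_zero]
      rw [abs_of_nonneg (hk'.le.trans h1)]
      linarith
    · have : 1 / ((k : ℝ) + 2) * dist x w ≤ dist x y := by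
        rw [h3]; exact mul_le_mul_of_nonneg_right h1 dist_nonneg
      rw [one_div, inv_mul_le_iff₀ hk] at this
      simp only
      rw [dist_comm w x]
      linarith

theorem extendable_eq_iUnion : extendable X = ⋃ k : ℕ,
    {p : X × X | ∃ t : ℝ, 1 / ((k : ℝ) + 2) ≤ t ∧ t ≤ 1 - 1 / ((k : ℝ) + 2) ∧
      ∃ w, DividesAt t p.1 p.2 w} := by
  ext p
  simp only [extendable, mem_ofPred_eq, mem_iUnion]
  constructor
  · rintro ⟨t, h0, h1, hw⟩
    obtain ⟨k, hk⟩ := exists_nat_one_div_lt (lt_min h0 (sub_pos.2 h1))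
    have hk' : 1 / ((k : ℝ) + 2) ≤ 1 / ((k : ℝ) + 1) :=
      one_div_le_one_div_of_le (by positivity) (by linarith)
    have := lt_min_iff.1 (hk'.trans_lt hk)
    exact ⟨k, t, this.1.le, by linarith [this.2], hw⟩
  · rintro ⟨k, t, h0, h1, hw⟩
    have hk' : 0 < 1 / ((k : ℝ) + 2) := by positivity
    exact ⟨t, by linarith, by linarith, hw⟩

theorem measurableSet_extendable [ProperSpace X] [MeasurableSpace X] [BorelSpace X] :
    MeasurableSet (extendable X) := by
  rw [extendable_eq_iUnion]
  exact MeasurableSet.iUnion fun k => (isClosed_setOf_exists_dividesAt k).measurableSet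

theorem IsBusemannConcave.continuous_geod_extendable [ProperSpace X] (hX : IsBusemannConcave X) :
    Continuous fun q : extendable X × I => ev q.2 (hX.1.geod q.1.1.1 q.1.1.2) := by
  rw [continuous_iff_isClosed]
  intro B hB
  let C : Set ((extendable X × I) × X) :=
    {q | q.2 ∈ B ∧ DividesAt (q.1.2 : ℝ) q.1.1.1.1 q.2 q.1.1.1.2}
  have hC : IsClosed C :=
    (hB.preimage continuous_snd).inter
      (isClosed_dividesAt (by fun_prop) (by fun_prop) (by fun_prop) (by fun_prop))
  convert isClosed_image_fst_of_dist_le hC (c := fun q => q.1.1.1)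
    (b := fun q => dist q.1.1.1 q.1.1.2) (by fun_prop) (by fun_prop) ?_ using 1
  · ext q
    constructor
    · intro hq
      refine ⟨(q, ev q.2 (hX.1.geod q.1.1.1 q.1.1.2)), ⟨hq, ?_⟩, rfl⟩
      simp only
      rw [ev_eq_pt]
      exact hX.1.dividesAt_geod _ _ q.2.2
    · rintro ⟨⟨q', w⟩, ⟨hw, hd⟩, rfl⟩
      simp only at hw hd
      rw [mem_preimage, ev_eq_pt, hX.pt_eq_of_dividesAt (w := w) _ q'.2.2]
      · exact hw
      · rwa [hX.1.ev_zero_geod, hX.1.ev_one_geod]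
      · rw [hX.1.ev_zero_geod, hX.1.ev_one_geod]
        exact q'.1.2
  · rintro ⟨q, w⟩ ⟨-, hd⟩
    simp only at hd ⊢
    rw [dist_comm, hd.1]
    exact mul_le_of_le_one_left dist_nonneg q.2.2.2

theorem IsBusemannConcave.continuousOn_pt_geod [ProperSpace X] (hX : IsBusemannConcave X) :
    ContinuousOn (fun q : (X × X) × ℝ => pt (hX.1.geod q.1.1 q.1.2) q.2)
      (extendable X ×ˢ univ) := by
  rw [continuousOn_iff_continuous_domRestrict]
  exact hX.continuous_geod_extendable.comp
    (f := fun q : (extendable X ×ˢ (univ : Set ℝ) : Set ((X × X) × ℝ)) =>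
      ((⟨q.1.1, q.2.1⟩ : extendable X), projIcc 0 1 zero_le_one q.1.2))
    ((by fun_prop : Continuous fun q : (extendable X ×ˢ (univ : Set ℝ) : Set ((X × X) × ℝ)) =>
      (⟨q.1.1, q.2.1⟩ : extendable X)).prodMk (continuous_projIcc.comp (by fun_prop)))

theorem IsBusemannConcave.continuousOn_geod [ProperSpace X] (hX : IsBusemannConcave X) (x : X) :
    ContinuousOn (hX.1.geod x) {y | (x, y) ∈ extendable X} := by
  rw [continuousOn_iff_continuous_domRestrict]
  let F : C({y // (x, y) ∈ extendable X}, C(I, X)) := ContinuousMap.curry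
    ⟨fun q => ev q.2 (hX.1.geod x q.1.1), hX.continuous_geod_extendable.comp
      (f := fun q : {y // (x, y) ∈ extendable X} × I =>
        ((⟨(x, q.1.1), q.1.2⟩ : extendable X), q.2)) (by fun_prop)⟩
  refine continuous_induced_rng.2 ?_
  exact F.continuous

end Selection

section Expanding

variable {X : Type*} [MetricSpace X] [MeasurableSpace X]

/-- Maps expanding distances by a factor `t` expand the measure of sets by the factor `t ^ n`. -/
def IsExpanding (μ : Measure X) (n : ℝ) : Prop :=
  ∀ (t : ℝ) (Φ : X → X), 0 < t → (∀ y z, t * dist y z ≤ dist (Φ y) (Φ z)) →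
    ∀ S : Set X, ENNReal.ofReal (t ^ n) * μ S ≤ μ (Φ '' S)

theorem isExpanding_hausdorff [BorelSpace X] {n : ℝ} (hn : 0 ≤ n) :
    IsExpanding (hausdorff X n) n := by
  intro t Φ ht hΦ S
  have hK : AntilipschitzWith (Real.toNNReal t)⁻¹ Φ := by
    refine AntilipschitzWith.of_le_mul_dist fun y z => ?_
    rw [NNReal.coe_inv, Real.coe_toNNReal _ ht.le, le_inv_mul_iff₀ ht]
    exact hΦ y z
  have h := hK.le_hausdorffMeasure_image hn S
  have ht' : ENNReal.ofReal t ≠ 0 := by simpa using ht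
  have e : (((Real.toNNReal t)⁻¹ : NNReal) : ℝ≥0∞) ^ n = (ENNReal.ofReal (t ^ n))⁻¹ := by
    rw [ENNReal.coe_inv (by simpa using ht), ENNReal.inv_rpow,
      ← ENNReal.ofReal_rpow_of_pos ht]
    rfl
  rw [e] at h
  have h0 : ENNReal.ofReal (t ^ n) ≠ 0 := by simpa using Real.rpow_pos_of_pos ht n
  simp only [hausdorff, Measure.smul_apply, smul_eq_mul]
  rw [mul_left_comm]
  gcongr
  rw [mul_comm, ← ENNReal.le_div_iff_mul_le (.inl h0) (.inl ENNReal.ofReal_ne_top),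
    ENNReal.div_eq_inv_mul]
  exact h

variable {μ : Measure X} {n : ℝ}

theorem IsExpanding.le_measure_image_geod (hμ : IsExpanding μ n) (hX : IsBusemannConcave X)
    (x : X) {t : ℝ} (ht0 : 0 < t) (ht1 : t ≤ 1) (S : Set X) :
    ENNReal.ofReal (t ^ n) * μ S ≤ μ ((fun y => pt (hX.1.geod x y) t) '' S) := by
  refine hμ t _ ht0 (fun y z => ?_) S
  have := hX.mul_dist_le (γ := hX.1.geod x y) (η := hX.1.geod x z)
    (by rw [hX.1.ev_zero_geod, hX.1.ev_zero_geod]) ⟨ht0.le, ht1⟩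
  rwa [hX.1.ev_one_geod, hX.1.ev_one_geod] at this

theorem IsExpanding.measure_preimage_geod_le (hμ : IsExpanding μ n) (hX : IsBusemannConcave X)
    (x : X) {t : ℝ} (ht0 : 0 < t) (ht1 : t ≤ 1) (B : Set X) :
    ENNReal.ofReal (t ^ n) * μ ((fun y => pt (hX.1.geod x y) t) ⁻¹' B) ≤ μ B :=
  (hμ.le_measure_image_geod hX x ht0 ht1 _).trans (measure_mono (image_preimage_subset _ _))

theorem IsExpanding.le_measure_ball (hμ : IsExpanding μ n) (hX : IsBusemannConcave X)
    (x : X) {t : ℝ} (ht0 : 0 < t) (ht1 : t ≤ 1) (R : ℝ) :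
    ENNReal.ofReal (t ^ n) * μ (Metric.ball x R) ≤ μ (Metric.ball x (t * R)) := by
  refine (hμ.le_measure_image_geod hX x ht0 ht1 _).trans (measure_mono ?_)
  rintro _ ⟨y, hy, rfl⟩
  rw [Metric.mem_ball', (hX.1.dividesAt_geod x y ⟨ht0.le, ht1⟩).1]
  exact mul_lt_mul_of_pos_left (Metric.mem_ball'.1 hy) ht0

theorem IsExpanding.ballsPosFinite (hμ : IsExpanding μ n) (hX : IsBusemannConcave X)
    (h : ∃ (x : X) (r : ℝ), 0 < r ∧ 0 < μ (Metric.ball x r) ∧ μ (Metric.ball x r) < ∞) :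
    BallsPosFinite μ := by
  obtain ⟨x₀, r, hr, hpos, hfin⟩ := h
  have hfin' : ∀ R, μ (Metric.ball x₀ R) < ∞ := by
    intro R
    set R' := max R r with hR'
    have hR0 : 0 < R' := lt_max_of_lt_right hr
    refine (measure_mono (Metric.ball_subset_ball (le_max_left R r))).trans_lt ?_
    have ht : 0 < r / R' := div_pos hr hR0
    have h1 := hμ.le_measure_ball hX x₀ ht ((div_le_one hR0).2 (le_max_right _ _)) R'
    rw [div_mul_cancel₀ _ hR0.ne'] at h1
    by_contra hc
    rw [not_lt, top_le_iff, ← hR'] at hc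
    rw [hc, ENNReal.mul_top (by simpa using Real.rpow_pos_of_pos ht n)] at h1
    exact absurd hfin (not_lt.2 h1)
  intro x s hs
  constructor
  · set R := dist x x₀ + r + s with hR
    have hd : 0 ≤ dist x x₀ := dist_nonneg
    have hR0 : 0 < R := by linarith
    have ht : 0 < s / R := div_pos hs hR0
    have h1 := hμ.le_measure_ball hX x ht ((div_le_one hR0).2 (by linarith)) R
    rw [div_mul_cancel₀ _ hR0.ne'] at h1
    refine lt_of_lt_of_le (ENNReal.mul_pos (by simpa using Real.rpow_pos_of_pos ht n) ?_) h1
    refine (hpos.trans_le (measure_mono (Metric.ball_subset_ball' ?_))).ne'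
    rw [dist_comm]; linarith
  · exact (measure_mono (Metric.ball_subset_ball' le_rfl)).trans_lt (hfin' (s + dist x x₀))

theorem IsExpanding.properSpace [BorelSpace X] [CompleteSpace X] (hμ : IsExpanding μ n)
    (hX : IsBusemannConcave X) (hb : BallsPosFinite μ) : ProperSpace X := by
  refine ProperSpace.of_isCompact_closedBall_of_le 0 fun x R hR => ?_
  refine TotallyBounded.isCompact_of_isClosed ?_ Metric.isClosed_closedBall
  rw [Metric.totallyBounded_iff]
  by_contra! hcon
  obtain ⟨ε, hε, hcov⟩ := hcon
  have : Std.Symm fun a b : X => ε ≤ dist a b := ⟨fun a b h => by rwa [dist_comm]⟩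
  obtain ⟨f, hfmem, hf⟩ := exists_seq_of_forall_finset_exists'
    (fun y => y ∈ Metric.closedBall x R) (fun a b => ε ≤ dist a b) (by
      intro s _
      obtain ⟨y, hy, hy'⟩ := not_subset.1 (hcov s s.finite_toSet)
      refine ⟨y, hy, fun z hz => ?_⟩
      by_contra hlt
      exact hy' (mem_biUnion (Finset.mem_coe.2 hz) (Metric.mem_ball'.2 (not_le.1 hlt))))
  have hR0 : 0 < R + ε := by linarith
  have ht : 0 < ε / 2 / (R + ε) := by positivity
  have hlow : ∀ i, ENNReal.ofReal ((ε / 2 / (R + ε)) ^ n) * μ (Metric.ball x ε) ≤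
      μ (Metric.ball (f i) (ε / 2)) := by
    intro i
    have h1 := hμ.le_measure_ball hX (f i) ht ((div_le_one hR0).2 (by linarith)) (R + ε)
    rw [div_mul_cancel₀ _ hR0.ne'] at h1
    refine le_trans ?_ h1
    gcongr
    refine Metric.ball_subset_ball' ?_
    have := Metric.mem_closedBall'.1 (hfmem i)
    linarith
  have hfinite := Measure.finite_const_le_meas_of_disjoint_iUnion μ
    (ε := ENNReal.ofReal ((ε / 2 / (R + ε)) ^ n) * μ (Metric.ball x ε))
    (As := fun i => Metric.ball (f i) (ε / 2))
    (ENNReal.mul_pos (by simpa using Real.rpow_pos_of_pos ht n) (hb x ε hε).1.ne')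
    (fun i => Metric.isOpen_ball.measurableSet)
    (fun i j hij => Metric.ball_disjoint_ball (by simpa using hf hij))
    (ne_top_of_le_ne_top (hb x (R + ε) hR0).2.ne (measure_mono (iUnion_subset fun i =>
      Metric.ball_subset_ball' (by linarith [Metric.mem_closedBall.1 (hfmem i)]))))
  simp only [hlow] at hfinite
  exact infinite_univ (by simpa using hfinite)

theorem IsExpanding.bishopGromovZero (hμ : IsExpanding μ n) (hX : IsBusemannConcave X)
    (hn : 0 ≤ n) (hb : BallsPosFinite μ) : BishopGromovZero μ n := by
  refine ⟨hb, fun x r R hr hrR => ?_⟩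
  have hR : 0 < R := hr.trans hrR
  have ht : 0 < r / R := div_pos hr hR
  have h := hμ.le_measure_ball hX x ht ((div_le_one hR).2 hrR.le) R
  rw [div_mul_cancel₀ _ hR.ne'] at h
  have hω : 0 < omega n :=
    div_pos (Real.rpow_pos_of_pos Real.pi_pos _) (Real.Gamma_pos_of_pos (by linarith))
  have e : modelVolume n R / modelVolume n r = ((r / R) ^ n)⁻¹ := by
    have h1 := Real.rpow_pos_of_pos hr n
    have h2 := Real.rpow_pos_of_pos hR n
    rw [modelVolume, modelVolume, Real.div_rpow hr.le hR.le]
    field_simp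
  have hp := Real.rpow_pos_of_pos ht n
  rw [e, ENNReal.ofReal_inv_of_pos hp]
  rw [ENNReal.div_le_iff (hb x r hr).1.ne' (hb x r hr).2.ne]
  rw [← ENNReal.div_eq_inv_mul, ENNReal.le_div_iff_mul_le (.inl (by simpa using hp))
    (.inl ENNReal.ofReal_ne_top), mul_comm]
  exact h

theorem IsExpanding.isDoublingWith (hμ : IsExpanding μ n) (hX : IsBusemannConcave X)
    (hb : BallsPosFinite μ) : IsDoublingWith μ ((2 : ℝ≥0∞) ^ n) := by
  refine ⟨hb, fun x r _ => ?_⟩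
  have h := hμ.le_measure_ball hX x (t := 2⁻¹) (by norm_num) (by norm_num) (2 * r)
  have e : ENNReal.ofReal ((2⁻¹ : ℝ) ^ n) = ((2 : ℝ≥0∞) ^ n)⁻¹ := by
    rw [← ENNReal.ofReal_rpow_of_pos (by norm_num), ENNReal.ofReal_inv_of_pos (by norm_num),
      ENNReal.inv_rpow]
    simp
  rw [inv_mul_cancel_left₀ (by norm_num), e] at h
  rwa [ENNReal.inv_mul_le_iff (by simp [ENNReal.rpow_eq_zero_iff])
    (by simp [ENNReal.rpow_eq_top_iff])] at h

theorem IsExpanding.ae_extendable [BorelSpace X] [ProperSpace X] (hμ : IsExpanding μ n)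
    (hX : IsBusemannConcave X) (hb : BallsPosFinite μ) (x : X) :
    ∀ᵐ y ∂μ, (x, y) ∈ extendable X := by
  set E : Set X := {y | (x, y) ∈ extendable X} with hE
  have hEm : MeasurableSet E := measurableSet_extendable.preimage measurable_prodMk_left
  have hball : ∀ k : ℕ, μ (Metric.ball x k \ E) = 0 := by
    intro k
    rcases k.eq_zero_or_pos with rfl | hk
    · simp
    set B := Metric.ball x (k : ℝ) with hB
    have hfin : μ B ≠ ∞ := (hb x k (by exact_mod_cast hk)).2.ne
    have hle : ∀ t : ℝ, t ∈ Ioo (0 : ℝ) 1 → ENNReal.ofReal (t ^ n) * μ B ≤ μ (B ∩ E) := by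
      intro t ht
      refine (hμ.le_measure_image_geod hX x ht.1 ht.2.le B).trans (measure_mono ?_)
      rintro _ ⟨y, hy, rfl⟩
      have hd := hX.1.dividesAt_geod x y ⟨ht.1.le, ht.2.le⟩
      refine ⟨?_, t, ht.1, ht.2, y, hd⟩
      rw [hB, Metric.mem_ball', hd.1]
      exact (mul_le_of_le_one_left dist_nonneg ht.2.le).trans_lt (Metric.mem_ball'.1 hy)
    have hlim : Tendsto (fun t : ℝ => ENNReal.ofReal (t ^ n) * μ B) (𝓝[<] 1) (𝓝 (μ B)) := by
      have h1 : Tendsto (fun t : ℝ => ENNReal.ofReal (t ^ n)) (𝓝[<] 1) (𝓝 1) := by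
        have : ContinuousAt (fun t : ℝ => t ^ n) 1 :=
          Real.continuousAt_rpow_const 1 n (.inl one_ne_zero)
        have h2 := (ENNReal.continuous_ofReal.continuousAt.comp this).tendsto
        simp only [Function.comp_def, Real.one_rpow, ENNReal.ofReal_one] at h2
        exact h2.mono_left nhdsWithin_le_nhds
      simpa using ENNReal.Tendsto.mul_const h1 (.inl one_ne_zero)
    have hge : μ B ≤ μ (B ∩ E) := by
      refine le_of_tendsto hlim ?_
      filter_upwards [Ioo_mem_nhdsLT (zero_lt_one' ℝ)] with t ht using hle t ht
    have hsum := measure_inter_add_sdiff (μ := μ) B hEm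
    have hfin' : μ (B ∩ E) ≠ ∞ := ne_top_of_le_ne_top hfin (measure_mono inter_subset_left)
    have : μ (B ∩ E) + μ (B \ E) ≤ μ (B ∩ E) + 0 := by rw [hsum, add_zero]; exact hge
    exact nonpos_iff_eq_zero.1 ((ENNReal.add_le_add_iff_left hfin').1 this)
  rw [ae_iff]
  refine measure_mono_null ?_ (measure_iUnion_null hball)
  intro y hy
  obtain ⟨k, hk⟩ := exists_nat_gt (dist y x)
  exact mem_iUnion.2 ⟨k, hk, hy⟩

end Expanding

section MeasureContraction

variable {X : Type*} [MetricSpace X] [MeasurableSpace X] [BorelSpace X] {μ : Measure X} {n : ℝ}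

theorem IsExpanding.subsingleton_of_zero (hμ : IsExpanding μ 0) (hX : IsBusemannConcave X)
    (hb : BallsPosFinite μ) : Subsingleton X := by
  refine ⟨fun x y => ?_⟩
  by_contra hne
  have hd : 0 < dist x y := dist_pos.2 hne
  have h1 := hμ.le_measure_ball hX x (t := 1 / 4) (by norm_num) (by norm_num) (2 * dist x y)
  rw [Real.rpow_zero, ENNReal.ofReal_one, one_mul,
    show 1 / 4 * (2 * dist x y) = dist x y / 2 by ring] at h1
  have hdisj : Disjoint (Metric.ball x (dist x y / 2)) (Metric.ball y (dist x y / 2)) :=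
    Metric.ball_disjoint_ball (by linarith)
  have h2 : μ (Metric.ball x (dist x y / 2)) + μ (Metric.ball y (dist x y / 2)) ≤
      μ (Metric.ball x (dist x y / 2)) + 0 := by
    rw [← measure_union hdisj Metric.isOpen_ball.measurableSet, add_zero]
    refine le_trans (measure_mono (union_subset ?_ ?_)) h1
    · exact Metric.ball_subset_ball (by linarith)
    · exact Metric.ball_subset_ball' (by rw [dist_comm y x]; linarith)
  have h3 := (ENNReal.add_le_add_iff_left (hb x _ (half_pos hd)).2.ne).1 h2
  exact absurd (hb y _ (half_pos hd)).1 (not_lt.2 h3)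

theorem IsExpanding.aemeasurable_geod [ProperSpace X] (hμ : IsExpanding μ n)
    (hX : IsBusemannConcave X) (hb : BallsPosFinite μ) (x : X) :
    AEMeasurable (hX.1.geod x) μ := by
  have hEm : MeasurableSet {y | (x, y) ∈ extendable X} :=
    measurableSet_extendable.preimage measurable_prodMk_left
  have := (hX.continuousOn_geod x).aemeasurable (μ := μ) hEm
  rwa [Measure.restrict_eq_self_of_ae_mem (s := {y | (x, y) ∈ extendable X})
    (hμ.ae_extendable hX hb x)] at this

theorem IsExpanding.mcpZero [CompleteSpace X] (hμ : IsExpanding μ n)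
    (hX : IsBusemannConcave X) (hn : 0 ≤ n) (hb : BallsPosFinite μ) : MCPZero μ n := by
  have := hμ.properSpace hX hb
  refine ⟨hb, fun x A hA hA0 hAfin => ?_⟩
  set ν : Measure X := (μ A)⁻¹ • μ.restrict A with hν
  have hνprob : IsProbabilityMeasure ν :=
    ⟨by simp [hν, ENNReal.inv_mul_cancel hA0.ne' hAfin.ne]⟩
  have hνμ : ν ≪ μ :=
    Measure.smul_absolutelyContinuous.trans Measure.restrict_le_self.absolutelyContinuous
  have hm : AEMeasurable (hX.1.geod x) ν := (hμ.aemeasurable_geod hX hb x).mono_ac hνμ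
  have hev : ∀ t : I, Measurable (ev t : Geod X → X) := fun t => (continuous_ev t).measurable
  have hmap : ∀ t : I, (ν.map (hX.1.geod x)).map (ev t) = ν.map fun y => ev t (hX.1.geod x y) :=
    fun t => AEMeasurable.map_map_of_aemeasurable (hev t).aemeasurable hm
  have hone : (ν.map (hX.1.geod x)).map (ev 1) = ν := by
    rw [hmap]
    simp only [hX.1.ev_one_geod]
    exact Measure.map_id'
  refine ⟨ν.map (hX.1.geod x), Measure.isProbabilityMeasure_map hm, ?_, hone, fun t => ?_⟩
  · rw [hmap]
    simp only [hX.1.ev_zero_geod]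
    simp [Measure.map_const]
  have hcancel : μ A • ν = μ.restrict A := by
    rw [hν, smul_smul, ENNReal.mul_inv_cancel hA0.ne' hAfin.ne, one_smul]
  rcases t.2.1.eq_or_lt with ht | ht
  · rcases hn.eq_or_lt with rfl | hn
    · have := hμ.subsingleton_of_zero hX hb
      rw [Subsingleton.elim (ev t) (ev 1 : Geod X → X), Measure.map_smul, hone, Real.rpow_zero,
        ENNReal.ofReal_one, one_mul, hcancel]
      exact Measure.restrict_le_self
    · simpa [← ht, Real.zero_rpow hn.ne'] using Measure.zero_le μ
  · refine Measure.le_iff.2 fun B hB => ?_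
    rw [Measure.map_smul, hmap, mul_smul, ← Measure.map_smul, hcancel, Measure.smul_apply,
      smul_eq_mul]
    have hm' : AEMeasurable (fun y => ev t (hX.1.geod x y)) (μ.restrict A) :=
      (hev t).comp_aemeasurable ((hμ.aemeasurable_geod hX hb x).mono_measure
        Measure.restrict_le_self)
    rw [Measure.map_apply_of_aemeasurable hm' hB]
    refine le_trans ?_ (hμ.measure_preimage_geod_le hX x ht t.2.2 B)
    simp only [ev_eq_pt]
    gcongr
    exact Measure.restrict_le_self

end MeasureContraction

section UpperGradients

variable {X : Type*} [MetricSpace X]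

theorem hasUnitSpeedOn_of_dist_eq {f : ℝ → X} {s : Set ℝ}
    (h : ∀ a ∈ s, ∀ b ∈ s, dist (f a) (f b) = |a - b|) : HasUnitSpeedOn f s := by
  rw [HasUnitSpeedOn, hasConstantSpeedOnWith_iff_ordered]
  intro a ha b hb hab
  have hed : ∀ c ∈ s, ∀ d ∈ s, edist (f c) (f d) = edist c d := fun c hc d hd => by
    rw [edist_dist, edist_dist, h c hc d hd, Real.dist_eq]
  have e : eVariationOn f (s ∩ Icc a b) = eVariationOn (id : ℝ → ℝ) (s ∩ Icc a b) := by
    refine iSup_congr fun p => Finset.sum_congr rfl fun i _ => ?_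
    exact hed _ (p.2.2.2 _).1 _ (p.2.2.2 _).1
  rw [e, NNReal.coe_one, one_mul]
  exact (monotone_id.monotoneOn s).eVariationOn_eq ha hb

theorem lintegral_Icc_zero_eq_mul {L : ℝ} (hL : 0 < L) (h : ℝ → ℝ≥0∞) :
    ∫⁻ s in Icc 0 L, h s = ENNReal.ofReal L * ∫⁻ t in Icc (0 : ℝ) 1, h (L * t) := by
  have himg : (fun t : ℝ => L * t) '' Icc (0 : ℝ) 1 = Icc 0 L := by
    rw [image_mul_left_Icc hL.le zero_le_one]; simp
  rw [← himg, lintegral_image_eq_lintegral_abs_deriv_mul (f' := fun _ => L) measurableSet_Icc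
    (fun t _ => by simpa using ((hasDerivAt_id t).const_mul L).hasDerivWithinAt)
    (fun a _ b _ hab => mul_left_cancel₀ hL.ne' hab), abs_of_pos hL,
    lintegral_const_mul' _ _ ENNReal.ofReal_ne_top]

theorem lintegral_unit_le_half_add_half (h : ℝ → ℝ≥0∞) :
    ∫⁻ t in Icc (0 : ℝ) 1, h t ≤
      (∫⁻ t in Icc (1 / 2 : ℝ) 1, h t) + ∫⁻ t in Icc (1 / 2 : ℝ) 1, h (1 - t) := by
  have himg : (fun t : ℝ => 1 - t) '' Icc (1 / 2 : ℝ) 1 = Icc 0 (1 / 2) := by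
    rw [image_const_sub_Icc]; norm_num
  have e : ∫⁻ t in Icc (0 : ℝ) (1 / 2), h t = ∫⁻ t in Icc (1 / 2 : ℝ) 1, h (1 - t) := by
    rw [← himg, lintegral_image_eq_lintegral_abs_deriv_mul (f' := fun _ => -1) measurableSet_Icc
      (fun t _ => by simpa using ((hasDerivAt_id t).const_sub 1).hasDerivWithinAt)
      (fun a _ b _ hab => sub_right_injective hab)]
    simp
  rw [← e, add_comm, ← Icc_union_Icc_eq_Icc (b := (1 / 2 : ℝ)) (by norm_num) (by norm_num)]
  exact lintegral_union_le _ _ _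

/-- An upper gradient inequality along all rectifiable curves, applied to a geodesic. -/
theorem ofReal_abs_sub_le_lintegral_geod {u : X → ℝ} {g : X → ℝ≥0∞}
    (hg : ∀ γ : RectCurve X,
      ENNReal.ofReal |u (γ.toFun 0) - u (γ.toFun γ.length)| ≤ γ.lineIntegral g) (γ : Geod X) :
    ENNReal.ofReal |u (ev 0 γ) - u (ev 1 γ)| ≤
      ENNReal.ofReal (dist (ev 0 γ) (ev 1 γ)) * ∫⁻ t in Icc (0 : ℝ) 1, g (pt γ t) := by
  rcases (dist_nonneg (x := ev 0 γ) (y := ev 1 γ)).eq_or_lt with hd | hd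
  · rw [dist_eq_zero.1 hd.symm]; simp
  set L := dist (ev 0 γ) (ev 1 γ) with hL
  have hmem : ∀ a ∈ Icc 0 L, a / L ∈ Icc (0 : ℝ) 1 := fun a ha =>
    ⟨div_nonneg ha.1 hd.le, (div_le_one hd).2 ha.2⟩
  have h := hg ⟨L, hd, fun s => pt γ (s / L), hasUnitSpeedOn_of_dist_eq (by
    intro a ha b hb
    rw [dist_pt γ (hmem a ha) (hmem b hb), ← hL, ← sub_div, abs_div, abs_of_pos hd,
      div_mul_cancel₀ _ hd.ne'])⟩
  simp only [RectCurve.lineIntegral, zero_div, div_self hd.ne', pt_zero, pt_one] at h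
  rw [lintegral_Icc_zero_eq_mul hd] at h
  simpa only [mul_div_cancel_left₀ _ hd.ne'] using h

/-- A family of vanishing modulus is contained in the family of curves along which some integrable
function has infinite line integral. -/
theorem exists_lineIntegral_eq_top_of_modulusOne_eq_zero [MeasurableSpace X] {μ : Measure X}
    {F : Set (RectCurve X)} (hF : modulusOne μ F = 0) :
    ∃ ρ : X → ℝ≥0∞, Measurable ρ ∧ ∫⁻ x, ρ x ∂μ ≠ ∞ ∧ ∀ γ ∈ F, γ.lineIntegral ρ = ∞ := by
  obtain ⟨ε, hε0, hc⟩ := ENNReal.exists_pos_sum_of_countable' (one_ne_zero (α := ℝ≥0∞)) ℕ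
  have hex : ∀ k, ∃ ρ : X → ℝ≥0∞, Measurable ρ ∧ (∀ γ ∈ F, 1 ≤ γ.lineIntegral ρ) ∧
      ∫⁻ x, ρ x ∂μ < ε k := by
    intro k
    have hlt : modulusOne μ F < ε k := hF ▸ hε0 k
    simp only [modulusOne, iInf_lt_iff] at hlt
    obtain ⟨ρ, h1, h2, h3⟩ := hlt
    exact ⟨ρ, h1, h2, h3⟩
  choose ρ hρm hρF hρ using hex
  refine ⟨fun x => ∑' k, ρ k x, Measurable.tsum hρm, ?_, fun γ hγ => ?_⟩
  · rw [lintegral_tsum fun k => (hρm k).aemeasurable]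
    exact ((ENNReal.tsum_le_tsum fun k => (hρ k).le).trans_lt (hc.trans_le le_top)).ne
  · have hN : ∀ N : ℕ, (N : ℝ≥0∞) ≤ γ.lineIntegral fun x => ∑ k ∈ Finset.range N, ρ k x := by
      intro N
      induction N with
      | zero => simp
      | succ N ih =>
        simp only [Finset.sum_range_succ]
        push_cast
        exact (add_le_add ih (hρF N γ hγ)).trans (le_lintegral_add _ _)
    refine ENNReal.eq_top_of_forall_nnreal_le fun r => ?_
    obtain ⟨N, hN'⟩ := exists_nat_gt r
    refine le_trans ?_ ((hN N).trans (lintegral_mono fun s => ENNReal.sum_le_tsum _))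
    exact_mod_cast hN'.le

open Classical in
/-- The chosen geodesics, modified on non-extendable pairs to be a measurable map. -/
noncomputable def IsBusemannConcave.flow (hX : IsBusemannConcave X) : (X × X) × ℝ → X :=
  (extendable X ×ˢ (univ : Set ℝ)).piecewise
    (fun q => pt (hX.1.geod q.1.1 q.1.2) q.2) fun q => q.1.1

theorem IsBusemannConcave.flow_of_extendable (hX : IsBusemannConcave X) {p : X × X}
    (hp : p ∈ extendable X) (t : ℝ) : hX.flow (p, t) = pt (hX.1.geod p.1 p.2) t := by
  classical
  exact piecewise_eq_of_mem _ _ _ ⟨hp, mem_univ _⟩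

/-- The integral of `g` along the half of the geodesic from `y` to `z` that is closer to `z`. -/
noncomputable def IsBusemannConcave.halfIntegral (hX : IsBusemannConcave X) (g : X → ℝ≥0∞)
    (p : X × X) : ℝ≥0∞ :=
  ENNReal.ofReal (dist p.1 p.2) * ∫⁻ t in Icc (1 / 2 : ℝ) 1, g (hX.flow (p, t))

theorem IsBusemannConcave.ofReal_abs_sub_le_halfIntegral (hX : IsBusemannConcave X) {u : X → ℝ}
    {g : X → ℝ≥0∞} (hg : ∀ γ : RectCurve X,
      ENNReal.ofReal |u (γ.toFun 0) - u (γ.toFun γ.length)| ≤ γ.lineIntegral g)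
    {y z : X} (h : (y, z) ∈ extendable X) (h' : (z, y) ∈ extendable X) :
    ENNReal.ofReal |u y - u z| ≤ hX.halfIntegral g (y, z) + hX.halfIntegral g (z, y) := by
  have h1 := ofReal_abs_sub_le_lintegral_geod hg (hX.1.geod y z)
  rw [hX.1.ev_zero_geod, hX.1.ev_one_geod] at h1
  refine h1.trans ?_
  rw [halfIntegral, halfIntegral, dist_comm (z, y).1, ← mul_add]
  gcongr
  refine (lintegral_unit_le_half_add_half _).trans (le_of_eq ?_)
  obtain ⟨θ, hθ0, hθ1, hθ⟩ := exists_geod_reverse (hX.1.geod y z)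
  rw [hX.1.ev_one_geod] at hθ0
  rw [hX.1.ev_zero_geod] at hθ1
  congr 1
  · simp only [hX.flow_of_extendable h]
  · refine setLIntegral_congr_fun measurableSet_Icc fun t ht => ?_
    have ht' : t ∈ Icc (0 : ℝ) 1 := ⟨le_trans (by norm_num) ht.1, ht.2⟩
    simp only [hX.flow_of_extendable h']
    rw [← hθ t ht', hX.pt_eq_of_extendable (η := hX.1.geod z y) _ _ _ ht']
    · rw [hθ0, hX.1.ev_zero_geod]
    · rw [hθ1, hX.1.ev_one_geod]
    · rwa [hθ0, hθ1]

end UpperGradients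

section Poincare

theorem ofReal_abs_sub_average_le {X : Type*} [MeasurableSpace X] {μ : Measure X} {u : X → ℝ}
    {B : Set X} (h0 : μ B ≠ 0) (hfin : μ B ≠ ∞)
    (hu : IntegrableOn u B μ) (c : ℝ) :
    ENNReal.ofReal |c - ⨍ z in B, u z ∂μ| ≤
      (μ B)⁻¹ * ∫⁻ z in B, ENNReal.ofReal |c - u z| ∂μ := by
  have hfm : IsFiniteMeasure (μ.restrict B) := ⟨by simpa using hfin.lt_top⟩
  have hpos : 0 < μ.real B := ENNReal.toReal_pos h0 hfin
  have e : c - ⨍ z in B, u z ∂μ = (μ.real B)⁻¹ * ∫ z in B, (c - u z) ∂μ := by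
    rw [setAverage_eq, integral_sub (integrable_const c) hu, setIntegral_const, smul_eq_mul,
      smul_eq_mul, mul_sub, inv_mul_cancel_left₀ hpos.ne']
  have e' : ENNReal.ofReal (μ.real B)⁻¹ = (μ B)⁻¹ := by
    rw [ENNReal.ofReal_inv_of_pos hpos, Measure.real, ENNReal.ofReal_toReal hfin]
  rw [e, abs_mul, abs_of_pos (inv_pos.2 hpos), ENNReal.ofReal_mul (inv_pos.2 hpos).le, e']
  gcongr
  have := enorm_integral_le_lintegral_enorm (μ := μ.restrict B) fun z => c - u z
  simpa only [Real.enorm_eq_ofReal_abs] using this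

variable {X : Type*} [MetricSpace X] [MeasurableSpace X] [BorelSpace X] {μ : Measure X} {n : ℝ}

theorem IsExpanding.lintegral_geod_le [ProperSpace X] (hμ : IsExpanding μ n)
    (hX : IsBusemannConcave X) (hn : 0 ≤ n) (hb : BallsPosFinite μ) (y : X) {t : ℝ}
    (ht : t ∈ Icc (1 / 2 : ℝ) 1) {f : X → ℝ≥0∞} (hf : Measurable f) :
    ∫⁻ z, f (pt (hX.1.geod y z) t) ∂μ ≤ 2 ^ n * ∫⁻ z, f z ∂μ := by
  have ht0 : 0 < t := lt_of_lt_of_le (by norm_num) ht.1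
  have hm : AEMeasurable (fun z => pt (hX.1.geod y z) t) μ :=
    (continuous_ev _).measurable.comp_aemeasurable (hμ.aemeasurable_geod hX hb y)
  have hle : μ.map (fun z => pt (hX.1.geod y z) t) ≤ (2 ^ n : ℝ≥0∞) • μ := by
    refine Measure.le_iff.2 fun B hB => ?_
    rw [Measure.map_apply_of_aemeasurable hm hB, Measure.smul_apply, smul_eq_mul]
    have h1 := hμ.measure_preimage_geod_le hX y ht0 ht.2 B
    have h2 : (1 : ℝ≥0∞) ≤ 2 ^ n * ENNReal.ofReal (t ^ n) := by
      rw [← ENNReal.ofReal_rpow_of_pos ht0, ← ENNReal.mul_rpow_of_nonneg _ _ hn]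
      rw [← ENNReal.one_rpow n]
      refine ENNReal.rpow_le_rpow ?_ hn
      rw [← ENNReal.ofReal_ofNat, ← ENNReal.ofReal_mul (by norm_num), ENNReal.one_le_ofReal]
      linarith [ht.1]
    calc _ ≤ (2 ^ n * ENNReal.ofReal (t ^ n)) * _ := le_mul_of_one_le_left' h2
      _ ≤ _ := by rw [mul_assoc]; gcongr
  rw [← lintegral_map' hf.aemeasurable hm, ← smul_eq_mul, ← lintegral_smul_measure]
  exact lintegral_mono' hle le_rfl

theorem IsBusemannConcave.measurable_flow [ProperSpace X] (hX : IsBusemannConcave X) :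
    Measurable hX.flow := by
  classical
  exact hX.continuousOn_pt_geod.measurable_piecewise (by fun_prop)
    (measurableSet_extendable.prod MeasurableSet.univ)

theorem IsBusemannConcave.measurable_halfIntegral [ProperSpace X] (hX : IsBusemannConcave X)
    {g : X → ℝ≥0∞} (hg : Measurable g) : Measurable (hX.halfIntegral g) :=
  (by fun_prop : Measurable fun p : X × X => ENNReal.ofReal (dist p.1 p.2)).mul
    (hg.comp hX.measurable_flow).lintegral_prod_right'

theorem IsExpanding.lintegral_halfIntegral_le [ProperSpace X] (hμ : IsExpanding μ n)
    (hX : IsBusemannConcave X) (hn : 0 ≤ n) (hb : BallsPosFinite μ) {g : X → ℝ≥0∞}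
    (hg : Measurable g) {x : X} {r : ℝ} (hr : 0 < r) {y : X} (hy : y ∈ Metric.ball x r) :
    ∫⁻ z in Metric.ball x r, hX.halfIntegral g (y, z) ∂μ ≤
      2 ^ n * ENNReal.ofReal r * ∫⁻ z in Metric.ball x (3 * r), g z ∂μ := by
  set B := Metric.ball x r with hB
  set M := ∫⁻ z in Metric.ball x (3 * r), g z ∂μ with hM
  have hfin : IsFiniteMeasure (μ.restrict B) := ⟨by simpa using (hb x r hr).2⟩
  have hsec : Measurable fun q : X × ℝ => g (hX.flow ((y, q.1), q.2)) :=
    hg.comp (hX.measurable_flow.comp (by fun_prop))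
  have hslice : ∀ t ∈ Icc (1 / 2 : ℝ) 1, ∫⁻ z in B, g (hX.flow ((y, z), t)) ∂μ ≤ 2 ^ n * M := by
    intro t ht
    have ht' : t ∈ Icc (0 : ℝ) 1 := ⟨le_trans (by norm_num) ht.1, ht.2⟩
    have hgi : Measurable ((Metric.ball x (3 * r)).indicator g) :=
      hg.indicator Metric.isOpen_ball.measurableSet
    have h1 := hμ.lintegral_geod_le hX hn hb y ht hgi
    rw [lintegral_indicator Metric.isOpen_ball.measurableSet, ← hM] at h1
    refine le_trans ?_ h1
    refine le_trans (lintegral_mono_ae ?_) (setLIntegral_le_lintegral B _)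
    filter_upwards [ae_restrict_of_ae (hμ.ae_extendable hX hb y),
      ae_restrict_mem Metric.isOpen_ball.measurableSet] with z hz hzB
    rw [hX.flow_of_extendable hz, indicator_of_mem]
    rw [Metric.mem_ball']
    have hd := (hX.1.dividesAt_geod y z ht').1
    have h2 := mul_le_of_le_one_left (dist_nonneg (x := y) (y := z)) ht.2
    have h3 := dist_triangle x y (pt (hX.1.geod y z) t)
    have h4 := dist_triangle_left y z x
    have h5 := Metric.mem_ball'.1 hy
    have h6 := Metric.mem_ball'.1 hzB
    linarith
  calc ∫⁻ z in B, hX.halfIntegral g (y, z) ∂μ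
      ≤ ∫⁻ z in B, (ENNReal.ofReal (2 * r) *
          ∫⁻ t in Icc (1 / 2 : ℝ) 1, g (hX.flow ((y, z), t))) ∂μ := by
        refine setLIntegral_mono' Metric.isOpen_ball.measurableSet fun z hz => ?_
        rw [IsBusemannConcave.halfIntegral]
        gcongr
        have h4 := dist_triangle_left y z x
        have h5 := Metric.mem_ball'.1 hy
        have h6 := Metric.mem_ball'.1 hz
        simp only
        linarith
    _ = ENNReal.ofReal (2 * r) *
          ∫⁻ t in Icc (1 / 2 : ℝ) 1, ∫⁻ z in B, g (hX.flow ((y, z), t)) ∂μ := by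
        rw [lintegral_const_mul' _ _ ENNReal.ofReal_ne_top]
        congr 1
        exact lintegral_lintegral_swap (f := fun z t => g (hX.flow ((y, z), t))) hsec.aemeasurable
    _ ≤ ENNReal.ofReal (2 * r) * ∫⁻ _t in Icc (1 / 2 : ℝ) 1, 2 ^ n * M := by
        gcongr ENNReal.ofReal (2 * r) * ?_
        exact setLIntegral_mono' measurableSet_Icc hslice
    _ = 2 ^ n * ENNReal.ofReal r * M := by
        rw [setLIntegral_const, Real.volume_Icc, mul_comm (2 ^ n * M), ← mul_assoc,
          ← ENNReal.ofReal_mul (by positivity), show 2 * r * (1 - 1 / 2) = r by ring]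
        ring

theorem IsExpanding.poincare_of_upperGradient [ProperSpace X] (hμ : IsExpanding μ n)
    (hX : IsBusemannConcave X) (hn : 0 ≤ n) (hb : BallsPosFinite μ) {u : X → ℝ} {g : X → ℝ≥0∞}
    (hgm : Measurable g) (hg : ∀ γ : RectCurve X,
      ENNReal.ofReal |u (γ.toFun 0) - u (γ.toFun γ.length)| ≤ γ.lineIntegral g)
    {x : X} {r : ℝ} (hr : 0 < r) (hu : IntegrableOn u (Metric.ball x r) μ) :
    ∫⁻ y in Metric.ball x r, ENNReal.ofReal |u y - ⨍ z in Metric.ball x r, u z ∂μ| ∂μ ≤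
      2 ^ (n + 1) * ENNReal.ofReal r * ∫⁻ y in Metric.ball x (3 * r), g y ∂μ := by
  obtain ⟨h0, hfin⟩ := hb x r hr
  set B := Metric.ball x r with hB
  set M := ∫⁻ z in Metric.ball x (3 * r), g z ∂μ with hM
  have hBm : MeasurableSet B := Metric.isOpen_ball.measurableSet
  have hfm : IsFiniteMeasure (μ.restrict B) := ⟨by simpa using hfin⟩
  have hJ := hX.measurable_halfIntegral hgm
  have hJ' : Measurable fun p : X × X => hX.halfIntegral g (p.2, p.1) := hJ.comp measurable_swap
  have hext : ∀ᵐ p ∂(μ.restrict B).prod (μ.restrict B), p ∈ extendable X := by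
    rw [ae_iff]
    refine (Measure.measure_prod_null measurableSet_extendable.compl).2 ?_
    exact Eventually.of_forall fun y => ae_restrict_of_ae (hμ.ae_extendable hX hb y)
  have hext' : ∀ᵐ p ∂(μ.restrict B).prod (μ.restrict B), (p.2, p.1) ∈ extendable X :=
    (Measure.measurePreserving_swap (μ := μ.restrict B)
      (ν := μ.restrict B)).quasiMeasurePreserving.ae hext
  have hae : ∀ᵐ y ∂μ.restrict B, ∀ᵐ z ∂μ.restrict B, ENNReal.ofReal |u y - u z| ≤
      hX.halfIntegral g (y, z) + hX.halfIntegral g (z, y) := by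
    refine Measure.ae_ae_of_ae_prod (p := fun p => ENNReal.ofReal |u p.1 - u p.2| ≤
      hX.halfIntegral g (p.1, p.2) + hX.halfIntegral g (p.2, p.1)) ?_
    filter_upwards [hext, hext'] with p hp hp'
    exact hX.ofReal_abs_sub_le_halfIntegral hg hp hp'
  have hI : ∫⁻ y in B, ∫⁻ z in B, hX.halfIntegral g (y, z) ∂μ ∂μ ≤
      μ B * (2 ^ n * ENNReal.ofReal r * M) := by
    refine (setLIntegral_mono' hBm fun y hy =>
      hμ.lintegral_halfIntegral_le hX hn hb hgm hr hy).trans ?_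
    rw [setLIntegral_const, mul_comm]
  calc ∫⁻ y in B, ENNReal.ofReal |u y - ⨍ z in B, u z ∂μ| ∂μ
      ≤ ∫⁻ y in B, (μ B)⁻¹ * ∫⁻ z in B,
          (hX.halfIntegral g (y, z) + hX.halfIntegral g (z, y)) ∂μ ∂μ := by
        refine lintegral_mono_ae ?_
        filter_upwards [hae] with y hy
        refine (ofReal_abs_sub_average_le h0.ne' hfin.ne hu (u y)).trans ?_
        gcongr 1
        exact lintegral_mono_ae hy
    _ = (μ B)⁻¹ * ((∫⁻ y in B, ∫⁻ z in B, hX.halfIntegral g (y, z) ∂μ ∂μ) +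
          ∫⁻ y in B, ∫⁻ z in B, hX.halfIntegral g (z, y) ∂μ ∂μ) := by
        rw [lintegral_const_mul' _ _ (ENNReal.inv_ne_top.2 h0.ne'),
          ← lintegral_add_left hJ.lintegral_prod_right']
        congr 1
        refine lintegral_congr fun y => ?_
        exact lintegral_add_left (hJ.comp measurable_prodMk_left) _
    _ = (μ B)⁻¹ * (2 * ∫⁻ y in B, ∫⁻ z in B, hX.halfIntegral g (y, z) ∂μ ∂μ) := by
        rw [lintegral_lintegral_swap (f := fun y z => hX.halfIntegral g (z, y)) hJ'.aemeasurable,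
          two_mul]
    _ ≤ (μ B)⁻¹ * (2 * (μ B * (2 ^ n * ENNReal.ofReal r * M))) := by gcongr
    _ = 2 ^ (n + 1) * ENNReal.ofReal r * M := by
        rw [ENNReal.rpow_add _ _ two_ne_zero ENNReal.ofNat_ne_top, ENNReal.rpow_one,
          mul_left_comm 2, ENNReal.inv_mul_cancel_left h0.ne' hfin.ne]
        ring

theorem IsExpanding.weakPoincareOneOne [ProperSpace X] (hμ : IsExpanding μ n)
    (hX : IsBusemannConcave X) (hn : 0 ≤ n) (hb : BallsPosFinite μ) :
    WeakPoincareOneOne μ (2 ^ (n + 1)) 3 := by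
  rintro x r hr u g hu ⟨hgm, hmod⟩
  obtain ⟨ρ, hρm, hρfin, hρ⟩ := exists_lineIntegral_eq_top_of_modulusOne_eq_zero hmod
  set C : ℝ≥0∞ := 2 ^ (n + 1) * ENNReal.ofReal r with hC
  set M := ∫⁻ y in Metric.ball x (3 * r), g y ∂μ with hM
  set N := ∫⁻ y in Metric.ball x (3 * r), ρ y ∂μ with hN
  have hNfin : N ≠ ∞ := ne_top_of_le_ne_top hρfin (setLIntegral_le_lintegral _ _)
  have hCfin : C ≠ ∞ := ENNReal.mul_ne_top
    (ENNReal.rpow_ne_top_of_nonneg (by linarith) ENNReal.ofNat_ne_top) ENNReal.ofReal_ne_top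
  have key : ∀ ε : ℝ≥0∞, ε ≠ 0 →
      ∫⁻ y in Metric.ball x r, ENNReal.ofReal |u y - ⨍ z in Metric.ball x r, u z ∂μ| ∂μ ≤
        C * (M + ε * N) := by
    intro ε hε
    have h1 := hμ.poincare_of_upperGradient hX hn hb (u := u) (g := fun y => g y + ε * ρ y)
      (hgm.add (hρm.const_mul ε)) (fun γ => ?_) hr hu
    · rwa [lintegral_add_left hgm, lintegral_const_mul _ hρm] at h1
    · by_cases hγ : ENNReal.ofReal |u (γ.toFun 0) - u (γ.toFun γ.length)| ≤ γ.lineIntegral g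
      · exact hγ.trans (lintegral_mono fun s => le_self_add)
      · have h2 : ε * γ.lineIntegral ρ ≤ γ.lineIntegral fun y => g y + ε * ρ y :=
          (lintegral_const_mul_le _ _).trans (lintegral_mono fun s => le_add_self)
        rw [hρ γ hγ, ENNReal.mul_top hε, top_le_iff] at h2
        rw [h2]
        exact le_top
  have hlim : Tendsto (fun ε : ℝ≥0∞ => C * (M + ε * N)) (𝓝[>] 0) (𝓝 (C * (M + 0 * N))) := by
    refine ENNReal.Tendsto.const_mul ?_ (.inr hCfin)
    refine tendsto_const_nhds.add (ENNReal.Tendsto.mul_const ?_ (.inr hNfin))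
    exact nhdsWithin_le_nhds
  rw [zero_mul, add_zero] at hlim
  refine ge_of_tendsto hlim ?_
  filter_upwards [self_mem_nhdsWithin] with ε hε using key ε (ne_of_gt hε)

end Poincare

end BusemannConcave

open BusemannConcave in
theorem mainTheorem2 (X : Type*) [MetricSpace X] [CompleteSpace X]
    [MeasurableSpace X] [BorelSpace X] (hX : IsBusemannConcave X)
    (n : ℝ) (hn : 0 ≤ n)
    (hnontriv : ∃ (x : X) (r : ℝ), 0 < r ∧
      0 < hausdorff X n (Metric.ball x r) ∧ hausdorff X n (Metric.ball x r) < ⊤) :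
    MCPZero (hausdorff X n) n ∧
    BishopGromovZero (hausdorff X n) n ∧
    IsDoublingWith (hausdorff X n) ((2 : ENNReal) ^ n) ∧
    WeakPoincareOneOne (hausdorff X n) ((2 : ENNReal) ^ (n + 1)) 3 := by
  have hμ : IsExpanding (hausdorff X n) n := isExpanding_hausdorff hn
  have hb := hμ.ballsPosFinite hX hnontriv
  have := hμ.properSpace hX hb
  exact ⟨hμ.mcpZero hX hn hb, hμ.bishopGromovZero hX hn hb, hμ.isDoublingWith hX hb,
    hμ.weakPoincareOneOne hX hn hb⟩
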